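/- Let $V:\mathbb R\to\mathbb R$ be twice differentiable with $\sup_t V''(t)\le 1$, positive for all sufficiently large $|t|$, and with $\liminf_{|t|\to\infty}\frac{\log V(t)}{\log|t|}>1$. For $L\in\mathbb N$ let $\Lambda_L=\{-L,\dots,L\}^2\subset\mathbb Z^2$. For $\varepsilon\ge 0$ and a field $h=(h_i)_{i\in\mathbb Z^2}$ of real numbers let $\mu_{\varepsilon,\Lambda_L}[h]$ be the finite-volume Gibbs measure on $\mathbb R^{\Lambda_L}$ with zero boundary condition and pinning of strength $\varepsilon$ at height zero, $$\mu_{\varepsilon,\Lambda_L}[h](d\varphi)=\frac{1}{Z_{\varepsilon,\Lambda_L}[h]}\exp\Bigl(-\tfrac18\sum_{\langle i,j\rangle\subset\Lambda_L}V(\varphi_i-\varphi_j)-\tfrac18\sum_{i\in\Lambda_L,\,j\notin\Lambda_L,\,|i-j|=1}V(\varphi_i)+\sum_{i\in\Lambda_L}h_i\varphi_i\Bigr)\prod_{i\in\Lambda_L}\bigl(d\varphi_i+\varepsilon\,\delta_0(d\varphi_i)\bigr),$$ where $Z_{\varepsilon,\Lambda_L}[h]$ is the normalizing constant and the first sum runs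 over unordered nearest-neighbour pairs (if $V$ is not even, $V(\varphi_i-\varphi_j)$ is replaced there by $\frac12(V(\varphi_i-\varphi_j)+V(\varphi_j-\varphi_i))$). Then $\mu_{\varepsilon,\Lambda_L}[h]$ is a well-defined probability measure under which every height $\varphi_i$ is integrable; write $\mu_{\varepsilon,\Lambda_L}[h](\varphi_i)$ for its expectation. Moreover, there is a constant $a>0$ such that for every family $\eta=(\eta_i)_{i\in\mathbb Z^2}$ of i.i.d., symmetrically distributed real random variables with finite second moment and for every $\varepsilon\ge0$ (so $a$ depends neither on the distribution of the $\eta_i$ nor on $\varepsilon$), $$\liminf_{L\to\infty}\frac{1}{L^2\log L}\,\mathbb E\Bigl(\sum_{i\in\Lambda_L}\eta_i\,\mu_{\varepsilon,\Lambda_L}[\eta](\varphi_i)\Bigr)\ \ge\ a\,\mathbb E(\eta_0^2),$$ where the expectation on the left exists in $(-\infty,+\infty]$ for all large $L$. If, for all large $L$ and all $i\in\Lambda_L$, the negative part of $\eta_i\,\mu_{\varepsilon,\Lambda_L}[\eta](\varphi_i)$ has finite expectation (for instance if these variables are integrable), then also $$\liminf_{L\to\infty}\frac{1}{L^2\log L}\sum_{i\in\Lambda_L}\mathbb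 E\Bigl(\eta_i\,\mu_{\varepsilon,\Lambda_L}[\eta](\varphi_i)\Bigr)\ \ge\ a\,\mathbb E(\eta_0^2).$$ -/

import Mathlib

open MeasureTheory ProbabilityTheory Filter
open scoped NNReal ENNReal

namespace PinnedInterface

noncomputable section

/-- The box `Λ_L` of side length `2 L + 1` in `ℤ^d`, centered at the origin. -/
def box (d L : ℕ) : Finset (Fin d → ℤ) :=
  Finset.Icc (fun _ => -(L : ℤ)) (fun _ => (L : ℤ))

/-- Nearest neighbours in `ℤ^d`. For integer points, distance one means the same thing
for the `ℓ¹` and for the Euclidean distance. -/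
def IsNN {d : ℕ} (i j : Fin d → ℤ) : Prop :=
  ∑ k, |i k - j k| = 1

instance {d : ℕ} (i j : Fin d → ℤ) : Decidable (IsNN i j) :=
  inferInstanceAs (Decidable (_ = _))

/-- The finite set of nearest neighbours of a site. -/
def nbrs {d : ℕ} (i : Fin d → ℤ) : Finset (Fin d → ℤ) :=
  (Finset.Icc (fun k => i k - 1) (fun k => i k + 1)).filter (fun j => IsNN i j)

theorem mem_nbrs {d : ℕ} (i j : Fin d → ℤ) : j ∈ nbrs i ↔ IsNN i j := by
  simp only [nbrs, Finset.mem_filter, Finset.mem_Icc, and_iff_right_iff_imp]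
  intro h
  have key : ∀ k, |i k - j k| ≤ 1 := fun k => by
    have := Finset.single_le_sum (f := fun k => |i k - j k|) (fun _ _ => abs_nonneg _)
      (Finset.mem_univ k)
    rw [IsNN] at h
    linarith
  constructor <;> intro k <;> have := abs_le.mp (key k) <;> simp only <;> omega

/-- The interaction energy of a height configuration `φ` in `Λ` with zero boundary condition:
`(1/4d) ∑_{⟨i,j⟩ ∈ Λ} V(φ_i - φ_j) + (1/4d) ∑_{i ∈ Λ, j ∉ Λ, |i-j|=1} V(φ_i)`.
The first sum is over unordered bonds; it is written as one half of the sum over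
ordered pairs. -/
def interaction {d : ℕ} (V : ℝ → ℝ) (Λ : Finset (Fin d → ℤ)) (φ : Λ → ℝ) : ℝ :=
  1 / (4 * (d : ℝ)) *
      (1 / 2 * ∑ i : Λ, ∑ j : Λ, if IsNN i.1 j.1 then V (φ i - φ j) else 0)
    + 1 / (4 * (d : ℝ)) * ∑ i : Λ, ∑ _j ∈ nbrs i.1 \ Λ, V (φ i)

/-- The a priori measure `∏_{i ∈ Λ} (dφ_i + ε δ_0(dφ_i))`. -/
def refMeasure {d : ℕ} (ε : ℝ≥0) (Λ : Finset (Fin d → ℤ)) : Measure (Λ → ℝ) :=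
  Measure.pi (fun _ : Λ => (volume : Measure ℝ) + ε • Measure.dirac (0 : ℝ))

/-- The quenched finite-volume Gibbs measure `μ_{ε,Λ}[h]` with pinning strength `ε` and
external field `h`: density `exp (-interaction + ∑ h_i φ_i) / Z` with respect to the
a priori measure. -/
def gibbs {d : ℕ} (V : ℝ → ℝ) (ε : ℝ≥0) (Λ : Finset (Fin d → ℤ)) (h : (Fin d → ℤ) → ℝ) :
    Measure (Λ → ℝ) :=
  (refMeasure ε Λ).tilted (fun φ => -interaction V Λ φ + ∑ i : Λ, h i.1 * φ i)

/-- The Gibbs expectation `μ_{ε,Λ}[h](φ_i)`. -/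
def gibbsMean {d : ℕ} (V : ℝ → ℝ) (ε : ℝ≥0) (Λ : Finset (Fin d → ℤ)) (h : (Fin d → ℤ) → ℝ)
    (i : Λ) : ℝ :=
  ∫ φ, φ i ∂(gibbs V ε Λ h)

/-- The expectation of a real random variable as an extended real number,
`E(X⁺) - E(X⁻)`. If both parts have infinite expectation its value is `⊥`,
so a lower bound by a real number includes that `E(X⁻)` is finite. -/
def extExpect {Ω : Type*} [MeasurableSpace Ω] (P : Measure Ω) (X : Ω → ℝ) : EReal :=
  ((∫⁻ ω, ENNReal.ofReal (X ω) ∂P : ℝ≥0∞) : EReal)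
    - ((∫⁻ ω, ENNReal.ofReal (-X ω) ∂P : ℝ≥0∞) : EReal)

/-- For integrable random variables `extExpect` is the usual expectation. -/
theorem extExpect_eq_integral {Ω : Type*} [MeasurableSpace Ω] {P : Measure Ω} {X : Ω → ℝ}
    (hX : Integrable X P) : extExpect P X = ((∫ ω, X ω ∂P : ℝ) : EReal) := by
  have h1 : ∫⁻ ω, ENNReal.ofReal (X ω) ∂P ≠ ∞ := hX.lintegral_lt_top.ne
  have h2 : ∫⁻ ω, ENNReal.ofReal (-X ω) ∂P ≠ ∞ := hX.neg.lintegral_lt_top.ne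
  rw [integral_eq_lintegral_pos_part_sub_lintegral_neg_part hX, extExpect, EReal.coe_sub,
    EReal.coe_ennreal_toReal h1, EReal.coe_ennreal_toReal h2]

end

end PinnedInterface

/-! Since `log Z[h]` is convex in the field `h` and its gradient is the Gibbs mean, the overlap of
`h` with that mean is at least `log Z[h] - log Z[0]` (`log_partition_sub_le_overlap`). The claim
thus becomes a comparison of free energies.

Without field, superlinear growth of `V` controls gradients along a forest rooted outside the box,
and integrating the heights out from the leaves gives `log Z[0] = O(L²)`
(`exists_log_partition_zero_le`). Pinning enters only here, through the volume-order constant, so it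
cannot affect the leading coefficient.

With field, restriction to unit cubes around a deterministic profile `ψ` costs a Dirichlet energy
plus volume-order terms, because `V'' ≤ 1` makes `V` at most quadratic (`le_log_partition`). The
profile is linear in the field: a superposition of truncated logarithms, which replace the
two-dimensional Green function. A logarithm of radius `R` has both height and Dirichlet energy of
order `log R`. For uncorrelated centred disorder only diagonal terms survive in expectation, so each
of the order `L²` centres gains a multiple of `E(η₀²) log L` (`integral_testProfile`), which beats
all `O(L²)` errors.

The overlap need not be integrable; it is bounded below by an integrable variable, which suffices
for extended expectations. -/

namespace PinnedInterface

noncomputable section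

/-! ### Pointwise bounds on the potential -/

/-- A potential whose second derivative is at most `1` lies below its osculating parabolas. -/
theorem le_taylor_of_deriv2_le_one {V : ℝ → ℝ} (hV1 : Differentiable ℝ V)
    (hV2 : Differentiable ℝ (deriv V)) (hV : ∀ t, deriv (deriv V) t ≤ 1) (t s : ℝ) :
    V (t + s) ≤ V t + deriv V t * s + s ^ 2 / 2 := by
  set F : ℝ → ℝ := fun x => x ^ 2 / 2 - V x with hF
  have hd : ∀ x, HasDerivAt F (x - deriv V x) x := fun x => by
    have h := ((hasDerivAt_pow 2 x).div_const 2).sub (hV1 x).hasDerivAt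
    have he : x - deriv V x = ((2 : ℕ) : ℝ) * x ^ (2 - 1) / 2 - deriv V x := by norm_num
    rw [he]
    exact h
  have hdF : deriv F = fun x => x - deriv V x := funext fun x => (hd x).deriv
  have hd2 : ∀ x, HasDerivAt (deriv F) (1 - deriv (deriv V) x) x := fun x => by
    rw [hdF]
    exact (hasDerivAt_id x).sub (hV2 x).hasDerivAt
  have hconv : ConvexOn ℝ Set.univ F := by
    apply convexOn_univ_of_deriv2_nonneg
    · exact fun x => (hd x).differentiableAt
    · exact fun x => (hd2 x).differentiableAt
    · intro x
      simp only [Function.iterate_succ, Function.iterate_zero, Function.comp, id]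
      rw [(hd2 x).deriv]
      linarith [hV x]
  -- The convex function `F` lies above its tangent lines; rearranged, this is the claim.
  have key : F t + (t - deriv V t) * s ≤ F (t + s) := by
    rcases lt_trichotomy s 0 with hs | hs | hs
    · have h := hconv.slope_le_of_hasDerivAt (Set.mem_univ (t + s)) (Set.mem_univ t)
        (by linarith) (hd t)
      rw [slope_def_field, div_le_iff₀ (by linarith)] at h
      linarith
    · simp [hs]
    · have h := hconv.le_slope_of_hasDerivAt (Set.mem_univ t) (Set.mem_univ (t + s))
        (by linarith) (hd t)
      rw [slope_def_field, le_div_iff₀ (by linarith)] at h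
      linarith
  simp only [hF] at key
  nlinarith

theorem exists_add_le_add_sq {V : ℝ → ℝ} (hV1 : Differentiable ℝ V)
    (hV2 : Differentiable ℝ (deriv V)) (hV : ∀ t, deriv (deriv V) t ≤ 1) :
    ∃ A, 0 ≤ A ∧ ∀ t s, |t| ≤ 1 → V (t + s) ≤ A + s ^ 2 := by
  have hcont : Continuous fun t => |V t| + deriv V t ^ 2 / 2 :=
    (hV1.continuous.abs).add ((hV2.continuous.pow 2).div_const 2)
  obtain ⟨A, hA⟩ := (isCompact_Icc (a := (-1 : ℝ)) (b := 1)).bddAbove_image hcont.continuousOn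
  have hA' : ∀ t, |t| ≤ 1 → |V t| + deriv V t ^ 2 / 2 ≤ A := fun t ht =>
    hA ⟨t, abs_le.mp ht, rfl⟩
  refine ⟨A, le_trans (by positivity) (hA' 0 (by simp)), fun t s ht => ?_⟩
  have h1 := le_taylor_of_deriv2_le_one hV1 hV2 hV t s
  -- The linear term is split by `V'(t) s ≤ V'(t)²/2 + s²/2`; this completes `s²/2` to `s²`, and `A`
  -- absorbs the rest.
  nlinarith [hA' t ht, le_abs_self (V t), sq_nonneg (deriv V t - s)]

/-- Superlinear growth in the logarithmic sense gives linear lower bounds with any slope. -/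
theorem exists_linear_le {V : ℝ → ℝ} (hV : Continuous V)
    (hVpos : ∀ᶠ t in comap (fun t : ℝ => |t|) atTop, 0 < V t)
    (hVgrowth : 1 < liminf (fun t : ℝ => ((Real.log (V t) / Real.log |t| : ℝ) : EReal))
      (comap (fun t : ℝ => |t|) atTop)) (K : ℝ) :
    ∃ C, 0 ≤ C ∧ ∀ t, K * |t| - C ≤ V t := by
  obtain ⟨p, hp1, hp2⟩ := EReal.lt_iff_exists_real_btwn.mp hVgrowth
  have hp1' : 1 < p := by exact_mod_cast hp1
  have hlt := eventually_lt_of_lt_liminf hp2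
  have habs : Tendsto (fun t : ℝ => |t|) (comap (fun t : ℝ => |t|) atTop) atTop := tendsto_comap
  have hpow : ∀ᶠ t in comap (fun t : ℝ => |t|) atTop, K ≤ |t| ^ (p - 1) :=
    ((tendsto_rpow_atTop (by linarith : 0 < p - 1)).comp habs).eventually_ge_atTop K
  have hev : ∀ᶠ t in comap (fun t : ℝ => |t|) atTop, K * |t| ≤ V t := by
    filter_upwards [hlt, hVpos, hpow, habs.eventually_gt_atTop 1] with t h1 h2 h3 h4
    have h1' : p < Real.log (V t) / Real.log |t| := by exact_mod_cast h1
    rw [lt_div_iff₀ (Real.log_pos h4)] at h1'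
    have h0 : 0 < |t| := by linarith
    have h5 : |t| ^ p ≤ V t := by
      rw [← Real.log_le_log_iff (Real.rpow_pos_of_pos h0 p) h2, Real.log_rpow h0]
      exact h1'.le
    -- As `p > 1`, the factor `|t| ^ (p - 1)` eventually exceeds any prescribed slope `K`.
    have h6 : |t| ^ p = |t| ^ (p - 1) * |t| := by
      rw [← Real.rpow_add_one h0.ne']; ring_nf
    nlinarith
  rw [eventually_comap] at hev
  obtain ⟨T, hT⟩ := eventually_atTop.mp hev
  obtain ⟨m, hm⟩ := (isCompact_Icc (a := -|T|) (b := |T|)).bddBelow_image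
    ((hV.sub (continuous_const.mul continuous_abs : Continuous fun t : ℝ => K * |t|)).continuousOn)
  refine ⟨|m|, abs_nonneg m, fun t => ?_⟩
  rcases le_or_gt |t| |T| with h | h
  · have := hm ⟨t, abs_le.mp h, rfl⟩
    simp only [Pi.sub_apply, Pi.mul_apply] at this
    linarith [neg_abs_le m]
  · have := hT |t| (by linarith [le_abs_self T]) t rfl
    linarith [abs_nonneg m]

/-! ### Integration along a ranked family of kernels -/

/-- Iterated integration of a product of kernels, each of which depends only on variables of
rank not larger than its own. -/
theorem lintegral_prod_le_pow_card {ι : Type*} [Fintype ι] [DecidableEq ι] (μ : Measure ℝ)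
    [SigmaFinite μ] (r : ι → ℤ) (k : ι → (ι → ℝ) → ℝ≥0∞) (hk : ∀ i, Measurable (k i))
    (hdep : ∀ i j, i ≠ j → r j ≤ r i → ∀ x y, k j (Function.update x i y) = k j x)
    (M : ℝ≥0∞) (hM : ∀ i x, ∫⁻ y, k i (Function.update x i y) ∂μ ≤ M) :
    ∫⁻ x, ∏ i, k i x ∂(Measure.pi fun _ : ι => μ) ≤ M ^ Fintype.card ι := by
  have key : ∀ s : Finset ι, ∀ x,
      lmarginal (fun _ : ι => μ) s (fun x => ∏ i ∈ s, k i x) x ≤ M ^ s.card := by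
    intro s
    -- The variable of maximal rank is integrated first: no other kernel in the product depends on
    -- it, so its integral yields a factor `M`.
    induction s using Finset.induction_on_max_value r with
    | empty => simp
    | insert i s hi hmax ih =>
      intro x
      rw [lmarginal_insert' _ (Finset.measurable_fun_prod _ fun j _ => hk j) hi,
        Finset.card_insert_of_notMem hi, pow_succ]
      have hle : (fun x => ∫⁻ y, ∏ j ∈ insert i s, k j (Function.update x i y) ∂μ)
          ≤ fun x => (∏ j ∈ s, k j x) * M := by
        intro x
        have : ∀ y, ∏ j ∈ insert i s, k j (Function.update x i y)
            = (∏ j ∈ s, k j x) * k i (Function.update x i y) := fun y => by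
          rw [Finset.prod_insert hi, mul_comm]
          congr 1
          exact Finset.prod_congr rfl fun j hj =>
            hdep i j (fun h => hi (h ▸ hj)) (hmax j hj) x y
        simp_rw [this]
        have hm : Measurable fun y => k i (Function.update x i y) :=
          (hk i).comp (measurable_update x)
        rw [lintegral_const_mul _ hm]
        gcongr
        exact hM i x
      refine (lmarginal_mono hle x).trans ?_
      have hm : Measurable fun y => ∏ j ∈ s, k j (Function.updateFinset x s y) :=
        (Finset.measurable_fun_prod _ fun j _ => hk j).comp measurable_updateFinset
      rw [lmarginal, lintegral_mul_const _ hm]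
      gcongr
      exact ih x
  rw [lintegral_eq_lmarginal_univ (μ := fun _ : ι => μ) (fun _ => 0)]
  exact key Finset.univ _

/-- The single-site a priori measure. -/
def siteMeasure (ε : ℝ≥0) : Measure ℝ := volume + ε • Measure.dirac 0

instance (ε : ℝ≥0) : SigmaFinite (siteMeasure ε) := by
  unfold siteMeasure; infer_instance

theorem integrable_exp_neg_abs : Integrable fun x : ℝ => Real.exp (-|x|) := by
  rw [← integrableOn_univ, ← Set.Iic_union_Ioi (a := (0 : ℝ)), integrableOn_union]
  constructor
  · refine (integrableOn_exp_Iic 0).congr_fun (fun x hx => ?_) measurableSet_Iic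
    simp [abs_of_nonpos (Set.mem_Iic.mp hx)]
  · refine (exp_neg_integrableOn_Ioi 0 one_pos).congr_fun (fun x hx => ?_) measurableSet_Ioi
    simp [abs_of_pos (Set.mem_Ioi.mp hx)]

/-- Uniform bound for the single-site integral of the kernel `exp (-|y - b|)`. -/
def siteBound (ε : ℝ≥0) : ℝ≥0∞ := (∫⁻ x : ℝ, ENNReal.ofReal (Real.exp (-|x|))) + ε

theorem siteBound_ne_top (ε : ℝ≥0) : siteBound ε ≠ ∞ :=
  ENNReal.add_ne_top.mpr ⟨integrable_exp_neg_abs.lintegral_lt_top.ne, ENNReal.coe_ne_top⟩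

/-- Translation invariance removes the centre `b` from the Lebesgue part, and the atom contributes
at most `ε`. Uniformity in `b` is what the iterated integration needs. -/
theorem lintegral_site_le (ε : ℝ≥0) (b : ℝ) :
    ∫⁻ y, ENNReal.ofReal (Real.exp (-|y - b|)) ∂(siteMeasure ε) ≤ siteBound ε := by
  rw [siteMeasure, lintegral_add_measure, siteBound]
  refine add_le_add ?_ ?_
  · rw [lintegral_sub_right_eq_self (fun x => ENNReal.ofReal (Real.exp (-|x|))) b]
  · rw [lintegral_smul_measure, lintegral_dirac]
    calc ε • ENNReal.ofReal (Real.exp (-|0 - b|)) ≤ ε • (1 : ℝ≥0∞) := by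
          gcongr
          rw [ENNReal.ofReal_le_one]
          exact Real.exp_le_one_iff.mpr (by simp)
      _ = ε := by simp [ENNReal.smul_def]

/-! ### Local form of the interaction and its upper and lower bounds -/

/-- Extension of a height configuration by zero. -/
def zeroExt {d : ℕ} {Λ : Finset (Fin d → ℤ)} (φ : Λ → ℝ) (x : Fin d → ℤ) : ℝ :=
  if h : x ∈ Λ then φ ⟨x, h⟩ else 0

theorem zeroExt_coe {d : ℕ} {Λ : Finset (Fin d → ℤ)} (φ : Λ → ℝ) (i : Λ) :
    zeroExt φ i.1 = φ i := by
  simp [zeroExt]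

theorem zeroExt_of_notMem {d : ℕ} {Λ : Finset (Fin d → ℤ)} (φ : Λ → ℝ) {x : Fin d → ℤ}
    (hx : x ∉ Λ) : zeroExt φ x = 0 := by
  simp [zeroExt, hx]

theorem zeroExt_update {d : ℕ} {Λ : Finset (Fin d → ℤ)} (φ : Λ → ℝ) (i : Λ) (y : ℝ)
    {x : Fin d → ℤ} (hx : x ≠ i.1) : zeroExt (Function.update φ i y) x = zeroExt φ x := by
  unfold zeroExt
  split_ifs with h
  · rw [Function.update_of_ne]
    rintro rfl
    exact hx rfl
  · rfl

theorem continuous_zeroExt {d : ℕ} {Λ : Finset (Fin d → ℤ)} (x : Fin d → ℤ) :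
    Continuous fun φ : Λ → ℝ => zeroExt φ x := by
  unfold zeroExt
  split_ifs with h
  · exact continuous_apply _
  · exact continuous_const

/-- The interaction as a sum of local terms, in which interior bonds are counted from both
endpoints with weight one half. -/
theorem interaction_eq_sum_nbrs (V : ℝ → ℝ) (Λ : Finset (Fin 2 → ℤ)) (φ : Λ → ℝ) :
    interaction V Λ φ = 1 / 8 * ∑ i : Λ, ∑ j ∈ nbrs i.1,
      (if j ∈ Λ then 1 / 2 else 1) * V (zeroExt φ i.1 - zeroExt φ j) := by
  have h1 : ∀ i : Λ, (∑ j : Λ, if IsNN i.1 j.1 then V (φ i - φ j) else 0)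
      = ∑ j ∈ nbrs i.1, if j ∈ Λ then V (zeroExt φ i.1 - zeroExt φ j) else 0 := by
    intro i
    have : ∀ j : Λ, (if IsNN i.1 j.1 then V (φ i - φ j) else 0)
        = (fun x => if IsNN i.1 x then V (zeroExt φ i.1 - zeroExt φ x) else 0) j.1 := fun j => by
      simp only [zeroExt_coe]
    simp_rw [this]
    rw [Finset.sum_coe_sort Λ (fun x => if IsNN i.1 x then V (zeroExt φ i.1 - zeroExt φ x) else 0),
      ← Finset.sum_filter, ← Finset.sum_filter]
    refine Finset.sum_congr ?_ fun _ _ => rfl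
    ext x
    simp only [Finset.mem_filter, mem_nbrs]
    tauto
  have h2 : ∀ i : Λ, (∑ _j ∈ nbrs i.1 \ Λ, V (φ i))
      = ∑ j ∈ nbrs i.1, if j ∈ Λ then 0 else V (zeroExt φ i.1 - zeroExt φ j) := by
    intro i
    rw [Finset.sdiff_eq_filter, Finset.sum_filter]
    refine Finset.sum_congr rfl fun j _ => ?_
    by_cases hj : j ∈ Λ
    · simp [hj]
    · simp [hj, zeroExt_of_notMem, zeroExt_coe]
  rw [interaction]
  simp_rw [h1, h2]
  have h8 : (1 : ℝ) / (4 * ((2 : ℕ) : ℝ)) = 1 / 8 := by norm_num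
  rw [h8, ← mul_add, Finset.mul_sum, ← Finset.sum_add_distrib]
  congr 1
  refine Finset.sum_congr rfl fun i _ => ?_
  rw [Finset.mul_sum, ← Finset.sum_add_distrib]
  refine Finset.sum_congr rfl fun j _ => ?_
  split_ifs <;> ring

theorem continuous_interaction {V : ℝ → ℝ} (hV : Continuous V) (Λ : Finset (Fin 2 → ℤ)) :
    Continuous (interaction V Λ) := by
  have : interaction V Λ = fun φ => 1 / 8 * ∑ i : Λ, ∑ j ∈ nbrs i.1,
      (if j ∈ Λ then 1 / 2 else 1) * V (zeroExt φ i.1 - zeroExt φ j) :=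
    funext fun φ => interaction_eq_sum_nbrs V Λ φ
  rw [this]
  refine continuous_const.mul (continuous_finsetSum _ fun i _ => continuous_finsetSum _
    fun j _ => continuous_const.mul (hV.comp ?_))
  exact (continuous_zeroExt _).sub (continuous_zeroExt _)

theorem card_nbrs_le (x : Fin 2 → ℤ) : (nbrs x).card ≤ 9 := by
  refine (Finset.card_filter_le _ _).trans ?_
  rw [Pi.card_Icc]
  have : ∀ k, x k + 1 + 1 - (x k - 1) = 3 := fun k => by ring
  simp [this]

/-- The neighbour of a site in the negative first coordinate direction. -/
def back (x : Fin 2 → ℤ) : Fin 2 → ℤ := x - Pi.single 0 1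

theorem back_zero (x : Fin 2 → ℤ) : back x 0 = x 0 - 1 := by simp [back]

theorem back_mem_nbrs (x : Fin 2 → ℤ) : back x ∈ nbrs x := by
  rw [mem_nbrs, IsNN]
  simp [back]

/-- The gradients of a configuration along the forest that joins each site to `back`. -/
def forestSum {Λ : Finset (Fin 2 → ℤ)} (φ : Λ → ℝ) : ℝ :=
  ∑ i : Λ, |φ i - zeroExt φ (back i.1)|

theorem forestSum_nonneg {Λ : Finset (Fin 2 → ℤ)} (φ : Λ → ℝ) : 0 ≤ forestSum φ :=
  Finset.sum_nonneg fun _ _ => abs_nonneg _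

/-- Only the bond to `back` is kept at each site. The slope `16 * K` compensates the prefactor `1/8`
and the smallest bond weight `1/2`; the constants lost are at most `9 * C / 8` per site. -/
theorem forestSum_le_interaction {V : ℝ → ℝ} {K C : ℝ} (hK : 0 ≤ K) (hC : 0 ≤ C)
    (hV : ∀ t, 16 * K * |t| - C ≤ V t) (Λ : Finset (Fin 2 → ℤ)) (φ : Λ → ℝ) :
    K * forestSum φ - 2 * C * Fintype.card Λ ≤ interaction V Λ φ := by
  rw [interaction_eq_sum_nbrs, forestSum]
  have hsite : ∀ i : Λ, 8 * K * |φ i - zeroExt φ (back i.1)| - 9 * C ≤ ∑ j ∈ nbrs i.1,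
      (if j ∈ Λ then 1 / 2 else 1) * V (zeroExt φ i.1 - zeroExt φ j) := by
    intro i
    calc 8 * K * |φ i - zeroExt φ (back i.1)| - 9 * C
        ≤ ∑ j ∈ nbrs i.1, 8 * K * |zeroExt φ i.1 - zeroExt φ j| - ∑ j ∈ nbrs i.1, C := by
          have h1 := Finset.single_le_sum
            (f := fun j => 8 * K * |zeroExt φ i.1 - zeroExt φ j|)
            (fun _ _ => by positivity) (back_mem_nbrs i.1)
          rw [zeroExt_coe] at h1
          simp only [zeroExt_coe] at h1 ⊢
          have h2 : ((nbrs i.1).card : ℝ) ≤ 9 := by exact_mod_cast card_nbrs_le i.1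
          rw [Finset.sum_const, nsmul_eq_mul]
          nlinarith
      _ ≤ _ := by
          rw [← Finset.sum_sub_distrib]
          refine Finset.sum_le_sum fun j _ => ?_
          have h := hV (zeroExt φ i.1 - zeroExt φ j)
          have h0 : 0 ≤ K * |zeroExt φ i.1 - zeroExt φ j| := by positivity
          split_ifs <;> linarith
  have hsum := Finset.sum_le_sum fun i (_ : i ∈ Finset.univ) => hsite i
  rw [Finset.sum_sub_distrib, ← Finset.mul_sum, Finset.sum_const, nsmul_eq_mul,
    Finset.card_univ] at hsum
  have : 0 ≤ C * (Fintype.card Λ : ℝ) := by positivity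
  linarith

/-- Both `φ` and `ψ` vanish outside `Λ`, and `φ - ψ` lies in `[0, 1]` everywhere, so their gradients
differ by at most `1` on every bond. The quadratic upper bound on `V` then applies with `s` the
gradient of `ψ`. -/
theorem interaction_le {V : ℝ → ℝ} {A : ℝ} (hA : 0 ≤ A)
    (hV : ∀ t s, |t| ≤ 1 → V (t + s) ≤ A + s ^ 2) (Λ : Finset (Fin 2 → ℤ))
    (ψ : (Fin 2 → ℤ) → ℝ) (hψ : ∀ x ∉ Λ, ψ x = 0) (φ : Λ → ℝ)
    (hφ : ∀ i : Λ, φ i ∈ Set.Icc (ψ i.1) (ψ i.1 + 1)) :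
    interaction V Λ φ ≤ 1 / 8 * ∑ i : Λ, ∑ j ∈ nbrs i.1, (ψ i.1 - ψ j) ^ 2
      + 2 * A * Fintype.card Λ := by
  rw [interaction_eq_sum_nbrs]
  have hext : ∀ x, zeroExt φ x - ψ x ∈ Set.Icc (0 : ℝ) 1 := by
    intro x
    by_cases hx : x ∈ Λ
    · have := hφ ⟨x, hx⟩
      rw [← zeroExt_coe φ] at this
      exact ⟨by linarith [this.1], by linarith [this.2]⟩
    · simp [zeroExt_of_notMem φ hx, hψ x hx]
  have hsite : ∀ i : Λ, ∑ j ∈ nbrs i.1,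
      (if j ∈ Λ then 1 / 2 else 1) * V (zeroExt φ i.1 - zeroExt φ j)
      ≤ ∑ j ∈ nbrs i.1, (ψ i.1 - ψ j) ^ 2 + 9 * A := by
    intro i
    calc _ ≤ ∑ j ∈ nbrs i.1, ((ψ i.1 - ψ j) ^ 2 + A) := by
          refine Finset.sum_le_sum fun j _ => ?_
          have hi := hext i.1
          have hj := hext j
          have h := hV ((zeroExt φ i.1 - ψ i.1) - (zeroExt φ j - ψ j)) (ψ i.1 - ψ j)
            (abs_le.mpr ⟨by linarith [hi.1, hj.2], by linarith [hi.2, hj.1]⟩)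
          have he : (zeroExt φ i.1 - ψ i.1) - (zeroExt φ j - ψ j) + (ψ i.1 - ψ j)
              = zeroExt φ i.1 - zeroExt φ j := by ring
          rw [he] at h
          have h0 := sq_nonneg (ψ i.1 - ψ j)
          split_ifs <;> linarith
      _ ≤ _ := by
          rw [Finset.sum_add_distrib, Finset.sum_const, nsmul_eq_mul]
          have h2 : ((nbrs i.1).card : ℝ) ≤ 9 := by exact_mod_cast card_nbrs_le i.1
          gcongr
  have hsum := Finset.sum_le_sum fun i (_ : i ∈ Finset.univ) => hsite i
  rw [Finset.sum_add_distrib, Finset.sum_const, nsmul_eq_mul, Finset.card_univ] at hsum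
  have : 0 ≤ A * (Fintype.card Λ : ℝ) := by positivity
  linarith

/-! ### Control of heights and integrals by the forest -/

theorem mem_box {L : ℕ} {x : Fin 2 → ℤ} :
    x ∈ box 2 L ↔ (-(L : ℤ) ≤ x 0 ∧ x 0 ≤ L) ∧ (-(L : ℤ) ≤ x 1 ∧ x 1 ≤ L) := by
  simp only [box, Finset.mem_Icc, Pi.le_def, Fin.forall_fin_two]
  tauto

theorem card_box (L : ℕ) : (box 2 L).card = (2 * L + 1) ^ 2 := by
  rw [box, Pi.card_Icc]
  have : (((L : ℤ) + 1 - -(L : ℤ)).toNat) = 2 * L + 1 := by omega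
  simp only [Int.card_Icc, this, Finset.prod_const, Finset.card_univ, Fintype.card_fin]

/-- Following `back` from any site leaves the box, where the height is zero, after at most `2 * L +
1` steps. Each increment is crudely bounded by the full forest sum. -/
theorem abs_le_forestSum {L : ℕ} (φ : box 2 L → ℝ) (i : box 2 L) :
    |φ i| ≤ (2 * L + 1) * forestSum φ := by
  have key : ∀ n : ℕ, ∀ x : Fin 2 → ℤ, x 0 < -(L : ℤ) + n → |zeroExt φ x| ≤ n * forestSum φ := by
    intro n
    induction n with
    | zero =>
      intro x hx
      rw [zeroExt_of_notMem φ (fun h => by have := (mem_box.mp h).1.1; push_cast at hx; omega)]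
      simp
    | succ n ih =>
      intro x hx
      by_cases h : x ∈ box 2 L
      · have h1 := ih (back x) (by rw [back_zero]; push_cast at hx; omega)
        have h2 : |φ ⟨x, h⟩ - zeroExt φ (back x)| ≤ forestSum φ :=
          Finset.single_le_sum (f := fun i : box 2 L => |φ i - zeroExt φ (back i.1)|)
            (fun _ _ => abs_nonneg _) (Finset.mem_univ (⟨x, h⟩ : box 2 L))
        have h3 : zeroExt φ x = φ ⟨x, h⟩ := zeroExt_coe φ ⟨x, h⟩
        have h4 : |φ ⟨x, h⟩| ≤ |φ ⟨x, h⟩ - zeroExt φ (back x)| + |zeroExt φ (back x)| := by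
          simpa using abs_add_le (φ ⟨x, h⟩ - zeroExt φ (back x)) (zeroExt φ (back x))
        rw [h3]
        push_cast
        linarith
      · rw [zeroExt_of_notMem φ h, abs_zero]
        have := forestSum_nonneg φ
        positivity
  have h := key (2 * L + 1) i.1 (by have := (mem_box.mp i.2).1.2; push_cast; omega)
  rw [zeroExt_coe] at h
  exact_mod_cast h

/-- The sites are ranked by first coordinate. The kernel at `i` involves only `φ i` and the height
at `back i`, whose rank is lower, so the ranked integration applies. -/
theorem lintegral_forest_le (ε : ℝ≥0) (Λ : Finset (Fin 2 → ℤ)) :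
    ∫⁻ φ, ENNReal.ofReal (Real.exp (-forestSum φ)) ∂(refMeasure ε Λ)
      ≤ siteBound ε ^ Fintype.card Λ := by
  have hprod : ∀ φ : Λ → ℝ, ENNReal.ofReal (Real.exp (-forestSum φ))
      = ∏ i : Λ, ENNReal.ofReal (Real.exp (-|φ i - zeroExt φ (back i.1)|)) := by
    intro φ
    rw [← ENNReal.ofReal_prod_of_nonneg fun _ _ => (Real.exp_pos _).le, ← Real.exp_sum,
      Finset.sum_neg_distrib, forestSum]
  simp_rw [hprod]
  refine lintegral_prod_le_pow_card (siteMeasure ε) (fun i : Λ => i.1 0)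
    (fun i φ => ENNReal.ofReal (Real.exp (-|φ i - zeroExt φ (back i.1)|))) ?_ ?_ _ ?_
  · intro i
    refine ENNReal.measurable_ofReal.comp (Continuous.measurable ?_)
    exact Real.continuous_exp.comp
      (((continuous_apply i).sub (continuous_zeroExt (back i.1))).abs.neg)
  · intro i j hij hr φ y
    have hb : back j.1 ≠ i.1 := fun h => by
      have := back_zero j.1
      rw [h] at this
      omega
    rw [Function.update_of_ne hij.symm, zeroExt_update φ i y hb]
  · intro i φ
    have hb : back i.1 ≠ i.1 := fun h => by
      have := back_zero i.1
      rw [h] at this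
      omega
    simp only [Function.update_self, zeroExt_update φ i _ hb]
    exact lintegral_site_le ε _

/-! ### Gibbs measures and free energy bounds -/

/-- The unnormalized log-density of the Gibbs measure. -/
def logDensity (V : ℝ → ℝ) (Λ : Finset (Fin 2 → ℤ)) (h : (Fin 2 → ℤ) → ℝ) (φ : Λ → ℝ) : ℝ :=
  -interaction V Λ φ + ∑ i : Λ, h i.1 * φ i

theorem gibbs_eq_tilted (V : ℝ → ℝ) (ε : ℝ≥0) (Λ : Finset (Fin 2 → ℤ)) (h : (Fin 2 → ℤ) → ℝ) :
    gibbs V ε Λ h = (refMeasure ε Λ).tilted (logDensity V Λ h) := rfl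

/-- The partition function. -/
def partition (V : ℝ → ℝ) (ε : ℝ≥0) (Λ : Finset (Fin 2 → ℤ)) (h : (Fin 2 → ℤ) → ℝ) : ℝ :=
  ∫ φ, Real.exp (logDensity V Λ h φ) ∂(refMeasure ε Λ)

instance (ε : ℝ≥0) (Λ : Finset (Fin 2 → ℤ)) : SigmaFinite (refMeasure ε Λ) :=
  inferInstanceAs (SigmaFinite (Measure.pi fun _ : Λ => siteMeasure ε))

/-- The Lebesgue part alone gives each unit interval mass `1`; the atom can only add to it, which
makes the lower bound on the free energy uniform in `ε`. -/
theorem one_le_refMeasure_pi_Icc (ε : ℝ≥0) (Λ : Finset (Fin 2 → ℤ)) (ψ : Λ → ℝ) :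
    1 ≤ refMeasure ε Λ (Set.univ.pi fun i => Set.Icc (ψ i) (ψ i + 1)) := by
  have : refMeasure ε Λ = Measure.pi fun _ : Λ => siteMeasure ε := rfl
  rw [this, Measure.pi_pi]
  refine Finset.one_le_prod' fun i _ => ?_
  rw [siteMeasure, Measure.add_apply, Real.volume_Icc]
  simp

instance (ε : ℝ≥0) (Λ : Finset (Fin 2 → ℤ)) : NeZero (refMeasure ε Λ) := by
  refine ⟨fun h => ?_⟩
  have := one_le_refMeasure_pi_Icc ε Λ fun _ => 0
  rw [h] at this
  simp at this

theorem continuous_logDensity {V : ℝ → ℝ} (hV : Continuous V) (Λ : Finset (Fin 2 → ℤ))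
    (h : (Fin 2 → ℤ) → ℝ) : Continuous (logDensity V Λ h) :=
  (continuous_interaction hV Λ).neg.add
    (continuous_finsetSum _ fun i _ => continuous_const.mul (continuous_apply i))

section Growth

variable {V : ℝ → ℝ}

theorem exists_neg_interaction_add_le (hV : ∀ K : ℝ, ∃ C, 0 ≤ C ∧ ∀ t, K * |t| - C ≤ V t)
    (L : ℕ) {B : ℝ} (hB : 0 ≤ B) :
    ∃ C, ∀ φ : box 2 L → ℝ,
      -interaction V (box 2 L) φ + B * ∑ i, |φ i| ≤ C - forestSum φ := by
  set N : ℝ := (Fintype.card (box 2 L) : ℝ)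
  set K : ℝ := 1 + B * (N * (2 * L + 1)) with hKdef
  have hK : 0 ≤ K := by positivity
  obtain ⟨C, hC, hVC⟩ := hV (16 * K)
  refine ⟨2 * C * N, fun φ => ?_⟩
  have h1 := forestSum_le_interaction hK hC hVC (box 2 L) φ
  have h2 : ∑ i, |φ i| ≤ N * ((2 * L + 1) * forestSum φ) := by
    refine (Finset.sum_le_sum fun i _ => abs_le_forestSum φ i).trans ?_
    rw [Finset.sum_const, nsmul_eq_mul, Finset.card_univ]
  have h3 := mul_le_mul_of_nonneg_left h2 hB
  have h4 : K * forestSum φ = forestSum φ + B * (N * ((2 * L + 1) * forestSum φ)) := by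
    rw [hKdef]; ring
  linarith

theorem integrable_exp_neg_interaction_add (hVc : Continuous V)
    (hV : ∀ K : ℝ, ∃ C, 0 ≤ C ∧ ∀ t, K * |t| - C ≤ V t) (ε : ℝ≥0) (L : ℕ)
    {g : (box 2 L → ℝ) → ℝ} (hg : Continuous g) {B : ℝ} (hB : 0 ≤ B)
    (hgB : ∀ φ, g φ ≤ B * ∑ i, |φ i|) :
    Integrable (fun φ => Real.exp (-interaction V (box 2 L) φ + g φ))
      (refMeasure ε (box 2 L)) := by
  obtain ⟨C, hC⟩ := exists_neg_interaction_add_le hV L hB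
  refine ⟨(Real.continuous_exp.comp
    ((continuous_interaction hVc _).neg.add hg)).aestronglyMeasurable, ?_⟩
  rw [hasFiniteIntegral_iff_ofReal (ae_of_all _ fun _ => (Real.exp_pos _).le)]
  calc ∫⁻ φ, ENNReal.ofReal (Real.exp (-interaction V (box 2 L) φ + g φ))
        ∂(refMeasure ε (box 2 L))
      ≤ ∫⁻ φ, ENNReal.ofReal (Real.exp C) * ENNReal.ofReal (Real.exp (-forestSum φ))
        ∂(refMeasure ε (box 2 L)) := by
        refine lintegral_mono fun φ => ?_
        rw [← ENNReal.ofReal_mul (Real.exp_pos _).le, ← Real.exp_add]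
        refine ENNReal.ofReal_le_ofReal (Real.exp_le_exp.mpr ?_)
        linarith [hC φ, hgB φ]
    _ = ENNReal.ofReal (Real.exp C) * ∫⁻ φ, ENNReal.ofReal (Real.exp (-forestSum φ))
        ∂(refMeasure ε (box 2 L)) := lintegral_const_mul' _ _ ENNReal.ofReal_ne_top
    _ < ∞ := ENNReal.mul_lt_top ENNReal.ofReal_lt_top
        ((lintegral_forest_le ε _).trans_lt
          (ENNReal.pow_lt_top (siteBound_ne_top ε).lt_top))

theorem sum_mul_le_sum_abs {Λ : Finset (Fin 2 → ℤ)} (h : (Fin 2 → ℤ) → ℝ) (φ : Λ → ℝ) :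
    ∑ i : Λ, h i.1 * φ i ≤ (∑ i : Λ, |h i.1|) * ∑ i, |φ i| := by
  rw [Finset.mul_sum]
  refine Finset.sum_le_sum fun i _ => (le_abs_self _).trans ?_
  rw [abs_mul]
  gcongr
  exact Finset.single_le_sum (f := fun i : Λ => |h i.1|) (fun _ _ => abs_nonneg _)
    (Finset.mem_univ i)

theorem integrable_exp_logDensity (hVc : Continuous V)
    (hV : ∀ K : ℝ, ∃ C, 0 ≤ C ∧ ∀ t, K * |t| - C ≤ V t) (ε : ℝ≥0) (L : ℕ)
    (h : (Fin 2 → ℤ) → ℝ) :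
    Integrable (fun φ => Real.exp (logDensity V (box 2 L) h φ)) (refMeasure ε (box 2 L)) :=
  integrable_exp_neg_interaction_add hVc hV ε L
    (continuous_finsetSum _ fun i _ => continuous_const.mul (continuous_apply i))
    (Finset.sum_nonneg fun _ _ => abs_nonneg _) (sum_mul_le_sum_abs h)

theorem isProbabilityMeasure_gibbs (hVc : Continuous V)
    (hV : ∀ K : ℝ, ∃ C, 0 ≤ C ∧ ∀ t, K * |t| - C ≤ V t) (ε : ℝ≥0) (L : ℕ)
    (h : (Fin 2 → ℤ) → ℝ) : IsProbabilityMeasure (gibbs V ε (box 2 L) h) :=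
  isProbabilityMeasure_tilted (integrable_exp_logDensity hVc hV ε L h)

theorem integrable_height (hVc : Continuous V)
    (hV : ∀ K : ℝ, ∃ C, 0 ≤ C ∧ ∀ t, K * |t| - C ≤ V t) (ε : ℝ≥0) (L : ℕ)
    (h : (Fin 2 → ℤ) → ℝ) (i : box 2 L) :
    Integrable (fun φ => φ i) (gibbs V ε (box 2 L) h) := by
  rw [gibbs_eq_tilted, integrable_tilted_iff (integrable_exp_logDensity hVc hV ε L h)]
  have hlin : Continuous fun φ : box 2 L → ℝ => ∑ i : box 2 L, h i.1 * φ i :=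
    continuous_finsetSum _ fun i _ => continuous_const.mul (continuous_apply i)
  -- Since `|φ i| ≤ exp |φ i|`, the height is absorbed into the exponent as one more term of linear
  -- growth.
  have hdom := integrable_exp_neg_interaction_add hVc hV ε L
    (g := fun φ => ∑ i : box 2 L, h i.1 * φ i + |φ i|)
    (hlin.add (continuous_apply i).abs)
    (B := ∑ i : box 2 L, |h i.1| + 1)
    (add_nonneg (Finset.sum_nonneg fun _ _ => abs_nonneg _) zero_le_one) (fun φ => by
      rw [add_mul, one_mul]
      refine add_le_add (sum_mul_le_sum_abs h φ) ?_
      exact Finset.single_le_sum (f := fun i => |φ i|) (fun _ _ => abs_nonneg _)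
        (Finset.mem_univ i))
  refine hdom.mono' ?_ (ae_of_all _ fun φ => ?_)
  · exact ((Real.continuous_exp.comp (continuous_logDensity hVc _ h)).smul
      (continuous_apply i)).aestronglyMeasurable
  · rw [norm_smul, Real.norm_eq_abs, Real.norm_eq_abs, abs_of_pos (Real.exp_pos _), ← add_assoc,
      Real.exp_add]
    refine mul_le_mul_of_nonneg_left ?_ (Real.exp_pos _).le
    linarith [Real.add_one_le_exp |φ i|]

theorem partition_pos (hVc : Continuous V)
    (hV : ∀ K : ℝ, ∃ C, 0 ≤ C ∧ ∀ t, K * |t| - C ≤ V t) (ε : ℝ≥0) (L : ℕ)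
    (h : (Fin 2 → ℤ) → ℝ) : 0 < partition V ε (box 2 L) h :=
  integral_exp_pos (integrable_exp_logDensity hVc hV ε L h)

theorem ofReal_partition (hVc : Continuous V)
    (hV : ∀ K : ℝ, ∃ C, 0 ≤ C ∧ ∀ t, K * |t| - C ≤ V t) (ε : ℝ≥0) (L : ℕ)
    (h : (Fin 2 → ℤ) → ℝ) : ENNReal.ofReal (partition V ε (box 2 L) h)
      = ∫⁻ φ, ENNReal.ofReal (Real.exp (logDensity V (box 2 L) h φ))
        ∂(refMeasure ε (box 2 L)) :=
  ofReal_integral_eq_lintegral_ofReal (integrable_exp_logDensity hVc hV ε L h)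
    (ae_of_all _ fun _ => (Real.exp_pos _).le)

/-- Without external field, the free energy is at most of the order of the volume. -/
theorem exists_log_partition_zero_le (hVc : Continuous V)
    (hV : ∀ K : ℝ, ∃ C, 0 ≤ C ∧ ∀ t, K * |t| - C ≤ V t) (ε : ℝ≥0) :
    ∃ C, ∀ L, Real.log (partition V ε (box 2 L) 0) ≤ C * Fintype.card (box 2 L) := by
  obtain ⟨C, hC, hVC⟩ := hV (16 * 1)
  -- Slope `1` on the forest suffices here, so `C` does not depend on `L`.
  refine ⟨2 * C + (siteBound ε).toReal, fun L => ?_⟩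
  set n := Fintype.card (box 2 L)
  have h1 : ENNReal.ofReal (partition V ε (box 2 L) 0)
      ≤ ENNReal.ofReal (Real.exp (2 * C * n)) * siteBound ε ^ n := by
    rw [ofReal_partition hVc hV]
    calc _ ≤ ∫⁻ φ, ENNReal.ofReal (Real.exp (2 * C * n))
            * ENNReal.ofReal (Real.exp (-forestSum φ)) ∂(refMeasure ε (box 2 L)) := by
          refine lintegral_mono fun φ => ?_
          rw [← ENNReal.ofReal_mul (Real.exp_pos _).le, ← Real.exp_add]
          refine ENNReal.ofReal_le_ofReal (Real.exp_le_exp.mpr ?_)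
          have := forestSum_le_interaction zero_le_one hC hVC (box 2 L) φ
          simp only [logDensity, Pi.zero_apply, zero_mul, Finset.sum_const_zero, add_zero]
          linarith
      _ = ENNReal.ofReal (Real.exp (2 * C * n)) * ∫⁻ φ,
            ENNReal.ofReal (Real.exp (-forestSum φ)) ∂(refMeasure ε (box 2 L)) :=
          lintegral_const_mul' _ _ ENNReal.ofReal_ne_top
      _ ≤ _ := by
          gcongr
          exact lintegral_forest_le ε _
  have h2 : siteBound ε ≤ ENNReal.ofReal (Real.exp (siteBound ε).toReal) := by
    rw [← ENNReal.ofReal_toReal (siteBound_ne_top ε)]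
    refine ENNReal.ofReal_le_ofReal ?_
    rw [ENNReal.toReal_ofReal ENNReal.toReal_nonneg]
    linarith [Real.add_one_le_exp (siteBound ε).toReal]
  have h3 : partition V ε (box 2 L) 0 ≤ Real.exp ((2 * C + (siteBound ε).toReal) * n) := by
    rw [← ENNReal.ofReal_le_ofReal_iff (Real.exp_pos _).le]
    refine h1.trans ?_
    calc _ ≤ ENNReal.ofReal (Real.exp (2 * C * n))
          * ENNReal.ofReal (Real.exp (siteBound ε).toReal) ^ n := by gcongr
      _ = _ := by
        rw [← ENNReal.ofReal_pow (Real.exp_pos _).le, ← ENNReal.ofReal_mul (Real.exp_pos _).le,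
          ← Real.exp_nat_mul, ← Real.exp_add]
        congr 2
        ring
  exact (Real.log_le_iff_le_exp (partition_pos hVc hV ε L 0)).mpr h3

/-- Lower bound on the free energy by restriction to unit cubes around a profile `ψ`. -/
theorem le_log_partition (hVc : Continuous V)
    (hV : ∀ K : ℝ, ∃ C, 0 ≤ C ∧ ∀ t, K * |t| - C ≤ V t) {A : ℝ} (hA : 0 ≤ A)
    (hVA : ∀ t s, |t| ≤ 1 → V (t + s) ≤ A + s ^ 2) (ε : ℝ≥0) (L : ℕ) (h ψ : (Fin 2 → ℤ) → ℝ)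
    (hψ : ∀ x ∉ box 2 L, ψ x = 0) :
    ∑ i : box 2 L, h i.1 * ψ i.1 - 1 / 8 * ∑ i : box 2 L, ∑ j ∈ nbrs i.1, (ψ i.1 - ψ j) ^ 2
      - ∑ i : box 2 L, |h i.1| - 2 * A * Fintype.card (box 2 L)
      ≤ Real.log (partition V ε (box 2 L) h) := by
  set c : ℝ := ∑ i : box 2 L, h i.1 * ψ i.1
      - 1 / 8 * ∑ i : box 2 L, ∑ j ∈ nbrs i.1, (ψ i.1 - ψ j) ^ 2
      - ∑ i : box 2 L, |h i.1| - 2 * A * Fintype.card (box 2 L) with hc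
  rw [Real.le_log_iff_exp_le (partition_pos hVc hV ε L h),
    ← ENNReal.ofReal_le_ofReal_iff (partition_pos hVc hV ε L h).le, ofReal_partition hVc hV]
  have hmeas : Measurable fun φ => ENNReal.ofReal (Real.exp (logDensity V (box 2 L) h φ)) :=
    ENNReal.measurable_ofReal.comp
      (Real.continuous_exp.comp (continuous_logDensity hVc _ h)).measurable
  refine le_trans ?_ (mul_meas_ge_le_lintegral hmeas (ENNReal.ofReal (Real.exp c)))
  refine le_mul_of_one_le_right' ?_
  -- The cube around `ψ` has mass at least `1`, so it is enough that the log-density is at least `c`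
  -- throughout it.
  refine (one_le_refMeasure_pi_Icc ε (box 2 L) fun i => ψ i.1).trans (measure_mono fun φ hφ => ?_)
  simp only [Set.mem_univ_pi] at hφ
  refine ENNReal.ofReal_le_ofReal (Real.exp_le_exp.mpr ?_)
  have h1 := interaction_le hA hVA (box 2 L) ψ hψ φ hφ
  have h2 : ∑ i : box 2 L, (h i.1 * ψ i.1 - |h i.1|) ≤ ∑ i : box 2 L, h i.1 * φ i := by
    refine Finset.sum_le_sum fun i _ => ?_
    have h3 : h i.1 * (ψ i.1 - φ i) ≤ |h i.1| := by
      refine (le_abs_self _).trans ?_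
      rw [abs_mul]
      refine mul_le_of_le_one_right (abs_nonneg _) (abs_le.mpr ?_)
      exact ⟨by linarith [(hφ i).2], by linarith [(hφ i).1]⟩
    linarith
  rw [Finset.sum_sub_distrib] at h2
  rw [logDensity]
  linarith

/-- The overlap of a field with its Gibbs mean dominates the free energy gained by the field. -/
theorem log_partition_sub_le_overlap (hVc : Continuous V)
    (hV : ∀ K : ℝ, ∃ C, 0 ≤ C ∧ ∀ t, K * |t| - C ≤ V t) (ε : ℝ≥0) (L : ℕ)
    (h : (Fin 2 → ℤ) → ℝ) :
    Real.log (partition V ε (box 2 L) h) - Real.log (partition V ε (box 2 L) 0)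
      ≤ ∑ i : box 2 L, h i.1 * gibbsMean V ε (box 2 L) h i := by
  have := isProbabilityMeasure_gibbs hVc hV ε L h
  set μ := gibbs V ε (box 2 L) h with hμ
  set m := ∑ i : box 2 L, h i.1 * gibbsMean V ε (box 2 L) h i with hm
  set g : (box 2 L → ℝ) → ℝ := fun φ => -∑ i : box 2 L, h i.1 * φ i with hg
  have hgi : Integrable g μ :=
    (integrable_finsetSum _ fun i _ => (integrable_height hVc hV ε L h i).const_mul _).neg
  have hgm : ∫ φ, g φ ∂μ = -m := by
    rw [hg, integral_neg, integral_finsetSum _ fun i _ =>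
      (integrable_height hVc hV ε L h i).const_mul _]
    simp_rw [integral_const_mul]
    rfl
  have hsum : logDensity V (box 2 L) h + g = logDensity V (box 2 L) 0 := by
    funext φ
    simp [logDensity, hg]
  have hexp : ∫ φ, Real.exp (g φ) ∂μ
      = partition V ε (box 2 L) 0 / partition V ε (box 2 L) h := by
    rw [hμ, gibbs_eq_tilted, integral_exp_tilted, hsum]
    rfl
  have hei : Integrable (fun φ => Real.exp (g φ)) μ := by
    rw [hμ, gibbs_eq_tilted, integrable_tilted_iff (integrable_exp_logDensity hVc hV ε L h)]
    refine (integrable_exp_logDensity hVc hV ε L 0).congr (ae_of_all _ fun φ => ?_)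
    simp only [smul_eq_mul]
    rw [← Real.exp_add, ← hsum, Pi.add_apply]
  -- Jensen's inequality for the exponential: `exp (-m) ≤ Z[0] / Z[h]`, since tilting by `g` removes
  -- the field.
  have hj : Real.exp (∫ φ, g φ ∂μ) ≤ ∫ φ, Real.exp (g φ) ∂μ :=
    convexOn_exp.map_integral_le Real.continuous_exp.continuousOn isClosed_univ
      (ae_of_all _ fun _ => Set.mem_univ _) hgi hei
  rw [hgm, hexp] at hj
  have h0 := partition_pos hVc hV ε L 0
  have h1 := partition_pos hVc hV ε L h
  have := (Real.le_log_iff_exp_le (div_pos h0 h1)).mpr hj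
  rw [Real.log_div h0.ne' h1.ne'] at this
  linarith

end Growth

/-! ### Measurability of the Gibbs mean in the field -/

theorem gibbsMean_eq_div (V : ℝ → ℝ) (ε : ℝ≥0) (Λ : Finset (Fin 2 → ℤ)) (h : (Fin 2 → ℤ) → ℝ)
    (i : Λ) : gibbsMean V ε Λ h i
      = (∫ φ, Real.exp (logDensity V Λ h φ) * φ i ∂(refMeasure ε Λ)) / partition V ε Λ h := by
  rw [gibbsMean, gibbs_eq_tilted, integral_tilted, ← integral_div]
  simp_rw [smul_eq_mul, partition, div_mul_eq_mul_div]

theorem measurable_gibbsMean {V : ℝ → ℝ} (hVc : Continuous V) (ε : ℝ≥0) (Λ : Finset (Fin 2 → ℤ))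
    (i : Λ) : Measurable fun h => gibbsMean V ε Λ h i := by
  have hd : Measurable fun p : ((Fin 2 → ℤ) → ℝ) × (Λ → ℝ) =>
      Real.exp (logDensity V Λ p.1 p.2) := by
    refine Real.measurable_exp.comp (Measurable.add ?_ ?_)
    · exact ((continuous_interaction hVc Λ).measurable.comp measurable_snd).neg
    · fun_prop
  simp_rw [gibbsMean_eq_div]
  refine Measurable.div ?_ ?_
  · exact (hd.mul (by fun_prop : Measurable fun p : ((Fin 2 → ℤ) → ℝ) × (Λ → ℝ) => p.2 i)
      ).stronglyMeasurable.integral_prod_right.measurable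
  · exact hd.stronglyMeasurable.integral_prod_right.measurable

/-! ### Logarithmic profiles and their Dirichlet energy -/

/-- The supremum norm of a lattice site. -/
def supNorm (x : Fin 2 → ℤ) : ℕ := max (x 0).natAbs (x 1).natAbs

theorem mem_box_iff_supNorm_le {L : ℕ} {x : Fin 2 → ℤ} : x ∈ box 2 L ↔ supNorm x ≤ L := by
  rw [mem_box, supNorm]
  omega

theorem supNorm_le_of_isNN {x y : Fin 2 → ℤ} (h : IsNN x y) :
    supNorm x ≤ supNorm y + 1 ∧ supNorm y ≤ supNorm x + 1 := by
  rw [IsNN, Fin.sum_univ_two, Int.abs_eq_natAbs, Int.abs_eq_natAbs] at h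
  unfold supNorm
  omega

/-- The truncated logarithmic profile `∑_{n ≤ m < R} 1 / (m + 1)`. -/
def logProfile (R n : ℕ) : ℝ := ∑ m ∈ Finset.Ico n R, 1 / ((m : ℝ) + 1)

theorem logProfile_of_le {R n : ℕ} (h : R ≤ n) : logProfile R n = 0 := by
  simp [logProfile, Finset.Ico_eq_empty_of_le h]

theorem logProfile_sub_succ (R n : ℕ) :
    0 ≤ logProfile R n - logProfile R (n + 1) ∧
      logProfile R n - logProfile R (n + 1) ≤ 1 / ((n : ℝ) + 1) := by
  have h0 : (0 : ℝ) ≤ 1 / ((n : ℝ) + 1) := by positivity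
  rcases lt_or_ge n R with h | h
  · have : logProfile R n = 1 / ((n : ℝ) + 1) + logProfile R (n + 1) :=
      Finset.sum_eq_sum_Ico_succ_bot h _
    rw [this]
    constructor <;> linarith
  · rw [logProfile_of_le h, logProfile_of_le (h.trans n.le_succ)]
    simpa using h0

theorem logProfile_zero_succ (R : ℕ) :
    logProfile (R + 1) 0 = logProfile R 0 + 1 / ((R : ℝ) + 1) :=
  Finset.sum_Ico_succ_top (Nat.zero_le R) _

theorem log_le_logProfile_zero (R : ℕ) : Real.log (R + 1) ≤ logProfile R 0 := by
  have h := log_add_one_le_harmonic R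
  have : ((harmonic R : ℚ) : ℝ) = logProfile R 0 := by
    rw [harmonic, logProfile, Finset.range_eq_Ico]
    push_cast
    simp
  rw [this] at h
  exact_mod_cast h

theorem one_le_logProfile_zero {R : ℕ} (hR : 1 ≤ R) : 1 ≤ logProfile R 0 := by
  have := Finset.single_le_sum (f := fun m : ℕ => 1 / ((m : ℝ) + 1)) (s := Finset.Ico 0 R)
    (fun _ _ => by positivity) (Finset.mem_Ico.mpr ⟨le_rfl, hR⟩)
  simpa [logProfile] using this

/-- Neighbouring norms differ by at most one. The worst case is a step inwards from norm `n + 1` to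
`n`, where the increment is at most `1 / (n + 1) ≤ 2 / (n + 2)`. Outside the box of radius `R` both
endpoints have norm at least `R`, where the profile vanishes. -/
theorem sq_logProfile_sub_le (R : ℕ) {x y : Fin 2 → ℤ} (h : IsNN x y) :
    (logProfile R (supNorm x) - logProfile R (supNorm y)) ^ 2
      ≤ if x ∈ box 2 R then 4 / ((supNorm x : ℝ) + 1) ^ 2 else 0 := by
  obtain ⟨h1, h2⟩ := supNorm_le_of_isNN h
  split_ifs with hx
  · have habs : |logProfile R (supNorm x) - logProfile R (supNorm y)|
        ≤ 2 / ((supNorm x : ℝ) + 1) := by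
      have hcases : supNorm y = supNorm x + 1 ∨ supNorm y = supNorm x
          ∨ supNorm x = supNorm y + 1 := by omega
      rcases hcases with e | e | e
      · rw [e]
        obtain ⟨h3, h4⟩ := logProfile_sub_succ R (supNorm x)
        rw [abs_of_nonneg h3]
        refine h4.trans ?_
        gcongr
        norm_num
      · rw [e, sub_self, abs_zero]
        positivity
      · rw [e]
        obtain ⟨h3, h4⟩ := logProfile_sub_succ R (supNorm y)
        rw [abs_sub_comm, abs_of_nonneg h3]
        refine h4.trans ?_
        push_cast
        rw [div_le_div_iff₀ (by positivity) (by positivity)]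
        nlinarith [Nat.cast_nonneg (α := ℝ) (supNorm y)]
    rw [← sq_abs]
    calc _ ≤ (2 / ((supNorm x : ℝ) + 1)) ^ 2 := by gcongr
      _ = _ := by rw [div_pow]; norm_num
  · rw [mem_box_iff_supNorm_le, not_le] at hx
    rw [logProfile_of_le hx.le, logProfile_of_le (by omega : R ≤ supNorm y)]
    simp

/-- The shell of norm `n ≥ 1` has `8 * n` sites with summand `1 / (n + 1) ^ 2`, hence contributes at
most `8 / (n + 1)`: a harmonic sum. This is where dimension two produces the logarithm. -/
theorem sum_box_inv_sq_le (R : ℕ) :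
    ∑ x ∈ box 2 R, 1 / ((supNorm x : ℝ) + 1) ^ 2 ≤ 8 * logProfile (R + 1) 0 := by
  induction R with
  | zero =>
    have h1 : ∑ x ∈ box 2 0, 1 / ((supNorm x : ℝ) + 1) ^ 2 ≤ ∑ x ∈ box 2 0, (1 : ℝ) := by
      refine Finset.sum_le_sum fun x _ => ?_
      rw [div_le_one (by positivity)]
      nlinarith [Nat.cast_nonneg (α := ℝ) (supNorm x)]
    rw [Finset.sum_const, card_box] at h1
    have h2 := one_le_logProfile_zero (R := 0 + 1) le_rfl
    norm_num at h1 h2 ⊢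
    linarith
  | succ R ih =>
    have hsub : box 2 R ⊆ box 2 (R + 1) := fun x hx => by
      rw [mem_box_iff_supNorm_le] at hx ⊢
      omega
    rw [← Finset.sum_sdiff hsub, logProfile_zero_succ (R + 1)]
    have hcard : (box 2 (R + 1) \ box 2 R).card = 8 * (R + 1) := by
      rw [Finset.card_sdiff_of_subset hsub, card_box, card_box, Nat.sub_eq_iff_eq_add]
      · ring
      · exact Nat.pow_le_pow_left (by omega) 2
    have h1 : ∑ x ∈ box 2 (R + 1) \ box 2 R, 1 / ((supNorm x : ℝ) + 1) ^ 2
        ≤ ∑ x ∈ box 2 (R + 1) \ box 2 R, 1 / ((R : ℝ) + 2) ^ 2 := by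
      refine Finset.sum_le_sum fun x hx => ?_
      rw [Finset.mem_sdiff, mem_box_iff_supNorm_le, mem_box_iff_supNorm_le] at hx
      have : (R : ℝ) + 1 ≤ supNorm x := by
        exact_mod_cast (by omega : R + 1 ≤ supNorm x)
      refine one_div_le_one_div_of_le (by positivity) (pow_le_pow_left₀ (by positivity) ?_ 2)
      linarith
    rw [Finset.sum_const, hcard, nsmul_eq_mul] at h1
    have h2 : ((8 * (R + 1) : ℕ) : ℝ) * (1 / ((R : ℝ) + 2) ^ 2)
        ≤ 8 * (1 / (((R + 1 : ℕ) : ℝ) + 1)) := by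
      push_cast
      rw [mul_one_div, mul_one_div, div_le_div_iff₀ (by positivity) (by positivity)]
      nlinarith [Nat.cast_nonneg (α := ℝ) R]
    linarith

/-- The Dirichlet energy of a translated logarithmic profile. -/
theorem dirichlet_logProfile_le {R : ℕ} (hR : 1 ≤ R) (S : Finset (Fin 2 → ℤ))
    (k : Fin 2 → ℤ) :
    ∑ i ∈ S, ∑ j ∈ nbrs i,
      (logProfile R (supNorm (i - k)) - logProfile R (supNorm (j - k))) ^ 2
      ≤ 576 * logProfile R 0 := by
  have hNN : ∀ i, ∀ j ∈ nbrs i, IsNN (i - k) (j - k) := fun i j hj => by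
    rw [mem_nbrs, IsNN] at hj
    simpa [IsNN] using hj
  have hsite : ∀ i, ∑ j ∈ nbrs i,
      (logProfile R (supNorm (i - k)) - logProfile R (supNorm (j - k))) ^ 2
      ≤ if i - k ∈ box 2 R then 36 * (1 / ((supNorm (i - k) : ℝ) + 1) ^ 2) else 0 := by
    intro i
    refine (Finset.sum_le_sum fun j hj => sq_logProfile_sub_le R (hNN i j hj)).trans ?_
    rw [Finset.sum_const, nsmul_eq_mul]
    have h9 : ((nbrs i).card : ℝ) ≤ 9 := by exact_mod_cast card_nbrs_le i
    split_ifs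
    · calc _ ≤ 9 * (4 / ((supNorm (i - k) : ℝ) + 1) ^ 2) := by gcongr
        _ = _ := by ring
    · simp
  calc _ ≤ ∑ i ∈ S,
        if i - k ∈ box 2 R then 36 * (1 / ((supNorm (i - k) : ℝ) + 1) ^ 2) else 0 :=
        Finset.sum_le_sum fun i _ => hsite i
    _ = ∑ x ∈ (S.filter fun i => i - k ∈ box 2 R).image fun i => i - k,
        36 * (1 / ((supNorm x : ℝ) + 1) ^ 2) := by
        rw [← Finset.sum_filter, Finset.sum_image fun _ _ _ _ h => sub_left_injective h]
    _ ≤ ∑ x ∈ box 2 R, 36 * (1 / ((supNorm x : ℝ) + 1) ^ 2) := by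
        refine Finset.sum_le_sum_of_subset_of_nonneg ?_ fun _ _ _ => by positivity
        intro x hx
        simp only [Finset.mem_image, Finset.mem_filter] at hx
        obtain ⟨i, ⟨_, h⟩, rfl⟩ := hx
        exact h
    _ ≤ 36 * (8 * logProfile (R + 1) 0) := by
        rw [← Finset.mul_sum]
        gcongr
        exact sum_box_inv_sq_le R
    _ ≤ _ := by
        have h1 : 1 / ((R : ℝ) + 1) ≤ 1 := by
          rw [div_le_one (by positivity)]
          linarith [Nat.cast_nonneg (α := ℝ) R]
        have h2 := one_le_logProfile_zero hR
        rw [logProfile_zero_succ]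
        linarith

/-- The scaled logarithmic profile of radius `R` centered at `k`, evaluated at `x`. -/
def testKernel (R : ℕ) (k x : Fin 2 → ℤ) : ℝ := 1 / 144 * logProfile R (supNorm (x - k))

/-- The test configuration for the field `h`: a superposition of logarithmic profiles. -/
def testProfile (R : ℕ) (h : (Fin 2 → ℤ) → ℝ) (x : Fin 2 → ℤ) : ℝ :=
  ∑ k ∈ box 2 R, testKernel R k x * h k

/-- Centres have norm at most `R` and the profiles have radius `R`, so the superposition is
supported in radius `2 * R`. It thus respects the zero boundary condition. -/
theorem testProfile_eq_zero {R L : ℕ} (hRL : 2 * R ≤ L) (h : (Fin 2 → ℤ) → ℝ)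
    {x : Fin 2 → ℤ} (hx : x ∉ box 2 L) : testProfile R h x = 0 := by
  refine Finset.sum_eq_zero fun k hk => ?_
  rw [mem_box_iff_supNorm_le] at hk hx
  have : R ≤ supNorm (x - k) := by
    simp only [supNorm, Pi.sub_apply] at *
    omega
  rw [testKernel, logProfile_of_le this]
  simp

theorem testKernel_self (R : ℕ) (k : Fin 2 → ℤ) : testKernel R k k = 1 / 144 * logProfile R 0 := by
  simp [testKernel, supNorm]

theorem dirichlet_testKernel_le {R : ℕ} (hR : 1 ≤ R) (S : Finset (Fin 2 → ℤ)) (k : Fin 2 → ℤ) :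
    ∑ i ∈ S, ∑ j ∈ nbrs i, (testKernel R k i - testKernel R k j) ^ 2
      ≤ 1 / 36 * logProfile R 0 := by
  have h := dirichlet_logProfile_le hR S k
  simp_rw [testKernel, ← mul_sub, mul_pow, ← Finset.mul_sum]
  linarith

/-! ### Extended expectations -/

section ExtExpect

variable {Ω : Type*} [MeasurableSpace Ω] {P : Measure Ω}

theorem integral_le_extExpect {W X : Ω → ℝ} (hW : Integrable W P) (h : ∀ ω, W ω ≤ X ω) :
    ((∫ ω, W ω ∂P : ℝ) : EReal) ≤ extExpect P X := by
  rw [← extExpect_eq_integral hW]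
  refine EReal.sub_le_sub ?_ ?_
  · exact EReal.coe_ennreal_le_coe_ennreal_iff.mpr
      (lintegral_mono fun ω => ENNReal.ofReal_le_ofReal (h ω))
  · exact EReal.coe_ennreal_le_coe_ennreal_iff.mpr
      (lintegral_mono fun ω => ENNReal.ofReal_le_ofReal (neg_le_neg (h ω)))

theorem integrable_of_extExpect_ne {X : Ω → ℝ} (hX : AEMeasurable X P)
    (hbot : extExpect P X ≠ ⊥) (htop : extExpect P X ≠ ⊤) : Integrable X P := by
  have hneg : ∫⁻ ω, ENNReal.ofReal (-X ω) ∂P ≠ ∞ := fun h => hbot (by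
    rw [extExpect, h, EReal.coe_ennreal_top, EReal.sub_top])
  have hpos : ∫⁻ ω, ENNReal.ofReal (X ω) ∂P ≠ ∞ := fun h => htop (by
    rw [extExpect, h, EReal.coe_ennreal_top, ← EReal.coe_ennreal_toReal hneg, EReal.top_sub_coe])
  refine ⟨hX.aestronglyMeasurable, ?_⟩
  rw [hasFiniteIntegral_iff_norm]
  have hle : ∀ ω, ENNReal.ofReal ‖X ω‖ ≤ ENNReal.ofReal (X ω) + ENNReal.ofReal (-X ω) := by
    intro ω
    rcases le_total 0 (X ω) with h | h
    · rw [Real.norm_of_nonneg h]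
      exact le_self_add
    · rw [Real.norm_of_nonpos h]
      exact le_add_self
  refine (lintegral_mono hle).trans_lt ?_
  rw [lintegral_add_left' hX.ennreal_ofReal]
  exact (ENNReal.add_ne_top.mpr ⟨hpos, hneg⟩).lt_top

/-- If a summand has expectation `⊤`, the right side is `⊤` because none is `⊥`. Otherwise all
summands are integrable and linearity gives equality. -/
theorem extExpect_sum_le {ι : Type*} [Fintype ι] {X : ι → Ω → ℝ}
    (hX : ∀ i, AEMeasurable (X i) P) (hbot : ∀ i, extExpect P (X i) ≠ ⊥) :
    extExpect P (fun ω => ∑ i, X i ω) ≤ ∑ i, extExpect P (X i) := by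
  classical
  by_cases htop : ∃ i, extExpect P (X i) = ⊤
  · obtain ⟨i, hi⟩ := htop
    have hrest : ∑ j ∈ Finset.univ.erase i, extExpect P (X j) ≠ ⊥ :=
      Finset.sum_induction _ (fun x : EReal => x ≠ ⊥)
        (fun _ _ ha hb => EReal.add_ne_bot_iff.mpr ⟨ha, hb⟩) EReal.zero_ne_bot
        fun j _ => hbot j
    rw [← Finset.add_sum_erase _ _ (Finset.mem_univ i), hi, EReal.top_add_of_ne_bot hrest]
    exact le_top
  · push Not at htop
    have hint : ∀ i, Integrable (X i) P := fun i =>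
      integrable_of_extExpect_ne (hX i) (hbot i) (htop i)
    rw [extExpect_eq_integral (integrable_finsetSum _ fun i _ => hint i),
      integral_finsetSum _ fun i _ => hint i]
    simp_rw [fun i => extExpect_eq_integral (hint i)]
    exact (map_sum (⟨⟨Real.toEReal, EReal.coe_zero⟩, EReal.coe_add⟩ : ℝ →+ EReal) _ _).le

end ExtExpect

/-! ### Averaging over the disorder and conclusion -/

section Field

variable {Ω : Type*} [MeasurableSpace Ω] {P : Measure Ω} {η : (Fin 2 → ℤ) → Ω → ℝ}

theorem integral_quadratic_form {σ : ℝ} (hint : ∀ i j, Integrable (fun ω => η i ω * η j ω) P)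
    (hcov : ∀ i j, ∫ ω, η i ω * η j ω ∂P = if i = j then σ else 0)
    {S T : Finset (Fin 2 → ℤ)} (hTS : T ⊆ S) (B : (Fin 2 → ℤ) → (Fin 2 → ℤ) → ℝ) :
    Integrable (fun ω => ∑ i ∈ S, ∑ k ∈ T, B i k * (η i ω * η k ω)) P ∧
      ∫ ω, ∑ i ∈ S, ∑ k ∈ T, B i k * (η i ω * η k ω) ∂P = σ * ∑ k ∈ T, B k k := by
  have h1 : ∀ i k, Integrable (fun ω => B i k * (η i ω * η k ω)) P := fun i k =>
    (hint i k).const_mul _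
  have h2 : ∀ i, Integrable (fun ω => ∑ k ∈ T, B i k * (η i ω * η k ω)) P := fun i =>
    integrable_finsetSum _ fun k _ => h1 i k
  refine ⟨integrable_finsetSum _ fun i _ => h2 i, ?_⟩
  rw [integral_finsetSum _ fun i _ => h2 i]
  simp_rw [integral_finsetSum _ fun k _ => h1 _ k, integral_const_mul, hcov]
  rw [Finset.sum_comm, Finset.mul_sum]
  refine Finset.sum_congr rfl fun k hk => ?_
  simp only [mul_ite, mul_zero, Finset.sum_ite_eq', hTS hk, if_true]
  ring

/-- Expected gain of the test configuration: order `L ^ 2 log L`. -/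
theorem integral_testProfile {σ : ℝ} (hσ : 0 ≤ σ)
    (hint : ∀ i j, Integrable (fun ω => η i ω * η j ω) P)
    (hcov : ∀ i j, ∫ ω, η i ω * η j ω ∂P = if i = j then σ else 0)
    {R L : ℕ} (hR : 1 ≤ R) (hRL : R ≤ L) :
    Integrable (fun ω => ∑ i ∈ box 2 L, η i ω * testProfile R (fun j => η j ω) i
      - 1 / 8 * ∑ i ∈ box 2 L, ∑ j ∈ nbrs i,
        (testProfile R (fun j => η j ω) i - testProfile R (fun j => η j ω) j) ^ 2) P ∧
    σ * ((box 2 R).card * (1 / 288 * logProfile R 0)) ≤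
      ∫ ω, (∑ i ∈ box 2 L, η i ω * testProfile R (fun j => η j ω) i
      - 1 / 8 * ∑ i ∈ box 2 L, ∑ j ∈ nbrs i,
        (testProfile R (fun j => η j ω) i - testProfile R (fun j => η j ω) j) ^ 2) ∂P := by
  have hsub : box 2 R ⊆ box 2 L := fun x hx => by
    rw [mem_box_iff_supNorm_le] at hx ⊢
    omega
  obtain ⟨i1, e1⟩ := integral_quadratic_form hint hcov hsub fun i k => testKernel R k i
  have f1 : ∀ ω, ∑ i ∈ box 2 L, η i ω * testProfile R (fun j => η j ω) i
      = ∑ i ∈ box 2 L, ∑ k ∈ box 2 R, testKernel R k i * (η i ω * η k ω) := fun ω => by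
    refine Finset.sum_congr rfl fun i _ => ?_
    rw [testProfile, Finset.mul_sum]
    exact Finset.sum_congr rfl fun k _ => by ring
  have q := fun i j => integral_quadratic_form hint hcov (Finset.Subset.refl (box 2 R))
    fun k l => (testKernel R k i - testKernel R k j) * (testKernel R l i - testKernel R l j)
  have f2 : ∀ i j ω, (testProfile R (fun j => η j ω) i - testProfile R (fun j => η j ω) j) ^ 2
      = ∑ k ∈ box 2 R, ∑ l ∈ box 2 R, (testKernel R k i - testKernel R k j)
        * (testKernel R l i - testKernel R l j) * (η k ω * η l ω) := fun i j ω => by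
    rw [testProfile, testProfile, ← Finset.sum_sub_distrib, sq, Finset.sum_mul_sum]
    exact Finset.sum_congr rfl fun k _ => Finset.sum_congr rfl fun l _ => by ring
  simp_rw [f1, f2]
  have i2 := integrable_finsetSum (box 2 L) fun i _ =>
    integrable_finsetSum (nbrs i) fun j _ => (q i j).1
  refine ⟨i1.sub (i2.const_mul _), ?_⟩
  rw [integral_sub i1 (i2.const_mul _), e1, integral_const_mul,
    integral_finsetSum _ fun i _ => integrable_finsetSum (nbrs i) fun j _ => (q i j).1]
  simp_rw [integral_finsetSum (nbrs _) fun j _ => (q _ j).1, (q _ _).2, ← Finset.mul_sum, ← sq,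
    testKernel_self]
  have hD : ∑ i ∈ box 2 L, ∑ j ∈ nbrs i, ∑ k ∈ box 2 R,
      (testKernel R k i - testKernel R k j) ^ 2 ≤ (box 2 R).card * (1 / 36 * logProfile R 0) := by
    have : ∑ i ∈ box 2 L, ∑ j ∈ nbrs i, ∑ k ∈ box 2 R,
        (testKernel R k i - testKernel R k j) ^ 2 = ∑ k ∈ box 2 R, ∑ i ∈ box 2 L, ∑ j ∈ nbrs i,
        (testKernel R k i - testKernel R k j) ^ 2 := by
      rw [Finset.sum_comm]
      exact Finset.sum_congr rfl fun i _ => Finset.sum_comm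
    rw [this, ← nsmul_eq_mul]
    exact Finset.sum_le_card_nsmul _ _ _ fun k _ => dirichlet_testKernel_le hR (box 2 L) k
  -- Per centre, in units of `σ * logProfile R 0`, the gain is `1/144` and the cost at most `1/8 *
  -- 1/36 = 1/288`. The scale `1/144` maximizes `c - 72 * c ^ 2`, with `72 = 576 / 8`, and leaves
  -- `1/288`.
  rw [Finset.sum_const, nsmul_eq_mul]
  nlinarith [mul_le_mul_of_nonneg_left hD hσ]

/-- After division the volume-order error is `D / log L`, which tends to zero. -/
theorem le_liminf_of_log_bound {s D : ℝ} {u : ℕ → EReal}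
    (hu : ∀ᶠ L : ℕ in atTop,
      ((s * ((L : ℝ) ^ 2 * Real.log L) - D * (L : ℝ) ^ 2 : ℝ) : EReal) ≤ u L) :
    (s : EReal) ≤
      liminf (fun L : ℕ => u L / (((L : ℝ) ^ 2 * Real.log L : ℝ) : EReal)) atTop := by
  have hlog : Tendsto (fun L : ℕ => Real.log L) atTop atTop :=
    Real.tendsto_log_atTop.comp tendsto_natCast_atTop_atTop
  have hlim : Tendsto (fun L : ℕ => ((s - D / Real.log L : ℝ) : EReal)) atTop
      (nhds (s : EReal)) := by
    refine (continuous_coe_real_ereal.tendsto s).comp ?_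
    simpa using (tendsto_const_nhds (x := s)).sub (hlog.const_div_atTop D)
  rw [← hlim.liminf_eq]
  refine liminf_le_liminf ?_
  filter_upwards [hu, eventually_ge_atTop 2] with L h1 h2
  have hL : (2 : ℝ) ≤ L := by exact_mod_cast h2
  have hpos : 0 < Real.log L := Real.log_pos (by linarith)
  have heq : s - D / Real.log L = (s * ((L : ℝ) ^ 2 * Real.log L) - D * (L : ℝ) ^ 2)
      / ((L : ℝ) ^ 2 * Real.log L) := by
    field_simp
  rw [heq, EReal.coe_div]
  exact EReal.div_le_div_right_of_nonneg (by exact_mod_cast (by positivity)) h1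

theorem covariance_of_iid [IsProbabilityMeasure P] (hind : iIndepFun η P)
    (hid : ∀ i, IdentDistrib (η i) (η 0) P P)
    (hsymm : IdentDistrib (η 0) (fun ω => -η 0 ω) P P) (hL2 : MemLp (η 0) 2 P) :
    (∀ i j, Integrable (fun ω => η i ω * η j ω) P) ∧
      ∀ i j, ∫ ω, η i ω * η j ω ∂P = if i = j then ∫ ω, η 0 ω ^ 2 ∂P else 0 := by
  have hmem : ∀ i, MemLp (η i) 2 P := fun i => (hid i).memLp_iff.mpr hL2
  refine ⟨fun i j => (hmem i).integrable_mul (hmem j), fun i j => ?_⟩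
  have hmean : ∫ ω, η 0 ω ∂P = 0 := by
    have := hsymm.integral_eq
    rw [integral_neg] at this
    linarith
  split_ifs with hij
  · subst hij
    rw [← (hid i).sq.integral_eq]
    exact integral_congr_ae (ae_of_all _ fun ω => (sq (η i ω)).symm)
  · rw [(hind.indepFun hij).integral_fun_mul_eq_mul_integral (hmem i).1 (hmem j).1,
      (hid i).integral_eq, hmean, zero_mul]

/-- Below the overlap there is an integrable random variable with large expectation. -/
theorem exists_integrable_le_overlap [IsProbabilityMeasure P] {V : ℝ → ℝ} (hVc : Continuous V)
    (hV : ∀ K : ℝ, ∃ C, 0 ≤ C ∧ ∀ t, K * |t| - C ≤ V t) {A : ℝ} (hA : 0 ≤ A)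
    (hVA : ∀ t s, |t| ≤ 1 → V (t + s) ≤ A + s ^ 2)
    (hind : iIndepFun η P) (hid : ∀ i, IdentDistrib (η i) (η 0) P P)
    (hsymm : IdentDistrib (η 0) (fun ω => -η 0 ω) P P) (hL2 : MemLp (η 0) 2 P) (ε : ℝ≥0) :
    ∃ D : ℝ, ∀ L : ℕ, 2 ≤ L → ∃ W : Ω → ℝ, Integrable W P ∧
      (∀ ω, W ω ≤ ∑ i : box 2 L, η i.1 ω * gibbsMean V ε (box 2 L) (fun j => η j ω) i) ∧
      1 / 288 * (∫ ω, η 0 ω ^ 2 ∂P) * ((L : ℝ) ^ 2 * Real.log L) - D * (L : ℝ) ^ 2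
        ≤ ∫ ω, W ω ∂P := by
  obtain ⟨C, hC⟩ := exists_log_partition_zero_le hVc hV ε
  obtain ⟨hint, hcov⟩ := covariance_of_iid hind hid hsymm hL2
  set σ := ∫ ω, η 0 ω ^ 2 ∂P with hσdef
  have hσ : 0 ≤ σ := integral_nonneg fun ω => sq_nonneg _
  set m := ∫ ω, |η 0 ω| ∂P with hm
  have hm0 : 0 ≤ m := integral_nonneg fun ω => abs_nonneg _
  have habs : ∀ i, Integrable (fun ω => |η i ω|) P := fun i =>
    (((hid i).memLp_iff.mpr hL2).integrable one_le_two).abs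
  -- The `log 2` is the loss from halving the radius; the factor `9` comes from `(2 * L + 1) ^ 2 ≤ 9
  -- * L ^ 2`.
  refine ⟨1 / 288 * σ * Real.log 2 + 9 * (m + 2 * A + |C|), fun L hL => ?_⟩
  -- Half the box size keeps the support of the test profile inside the box, while `L ≤ 2 * R + 1`
  -- still leaves at least `L ^ 2` centres.
  set R := L / 2 with hRdef
  have hR : 1 ≤ R := by omega
  obtain ⟨hi, hE⟩ := integral_testProfile hσ hint hcov hR (by omega : R ≤ L)
  set n : ℝ := ((box 2 L).card : ℝ) with hn
  set Q : Ω → ℝ := fun ω => ∑ i ∈ box 2 L, η i ω * testProfile R (fun j => η j ω) i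
      - 1 / 8 * ∑ i ∈ box 2 L, ∑ j ∈ nbrs i,
        (testProfile R (fun j => η j ω) i - testProfile R (fun j => η j ω) j) ^ 2 with hQ
  have hiabs : Integrable (fun ω => ∑ i ∈ box 2 L, |η i ω|) P :=
    integrable_finsetSum _ fun i _ => habs i
  refine ⟨fun ω => Q ω - ∑ i ∈ box 2 L, |η i ω| - (2 * A + C) * n,
    (hi.sub hiabs).sub (integrable_const _), fun ω => ?_, ?_⟩
  · have h1 := log_partition_sub_le_overlap hVc hV ε L (fun j => η j ω)
    have h2 := le_log_partition hVc hV hA hVA ε L (fun j => η j ω)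
      (testProfile R fun j => η j ω) fun x hx => testProfile_eq_zero (by omega) _ hx
    have h3 := hC L
    rw [Fintype.card_coe] at h2 h3
    rw [Finset.sum_coe_sort (box 2 L) fun i => η i ω * testProfile R (fun j => η j ω) i,
      Finset.sum_coe_sort (box 2 L) fun i => |η i ω|,
      Finset.sum_coe_sort (box 2 L) fun i => ∑ j ∈ nbrs i,
        (testProfile R (fun j => η j ω) i - testProfile R (fun j => η j ω) j) ^ 2] at h2
    simp only [hQ]
    linarith
  · have hi2 : Integrable (fun ω => Q ω - ∑ i ∈ box 2 L, |η i ω|) P := hi.sub hiabs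
    rw [integral_sub hi2 (integrable_const _), integral_sub hi hiabs,
      integral_finsetSum _ fun i _ => habs i, integral_const]
    have hmi : ∀ i, ∫ ω, |η i ω| ∂P = m := fun i => (hid i).norm.integral_eq
    simp_rw [hmi]
    rw [Finset.sum_const, nsmul_eq_mul, probReal_univ, one_smul, ← hn]
    have hL' : (2 : ℝ) ≤ L := by exact_mod_cast hL
    have hn9 : n ≤ 9 * (L : ℝ) ^ 2 := by
      rw [hn, card_box]
      push_cast
      nlinarith
    have hRcard : (L : ℝ) ^ 2 ≤ (box 2 R).card := by
      rw [card_box]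
      exact_mod_cast Nat.pow_le_pow_left (by omega : L ≤ 2 * R + 1) 2
    have hlog : Real.log L - Real.log 2 ≤ logProfile R 0 := by
      refine le_trans ?_ (log_le_logProfile_zero R)
      rw [← Real.log_div (by positivity) (by norm_num)]
      refine Real.log_le_log (by positivity) ?_
      rw [div_le_iff₀ (by norm_num)]
      exact_mod_cast (by omega : L ≤ (R + 1) * 2)
    have hprod : (L : ℝ) ^ 2 * (Real.log L - Real.log 2) ≤ (box 2 R).card * logProfile R 0 := by
      refine mul_le_mul hRcard hlog ?_ (by positivity)
      rw [sub_nonneg]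
      exact Real.log_le_log (by norm_num) hL'
    have h1 := mul_le_mul_of_nonneg_left hprod hσ
    have h2 : (m + 2 * A + C) * n ≤ (m + 2 * A + |C|) * (9 * (L : ℝ) ^ 2) :=
      mul_le_mul (by linarith [le_abs_self C]) hn9 (by positivity) (by positivity)
    linarith

end Field

end

end PinnedInterface

theorem theorem1 (V : ℝ → ℝ)
    (hV1 : Differentiable ℝ V) (hV2 : Differentiable ℝ (deriv V))
    (hVsup : ∀ t, deriv (deriv V) t ≤ 1)
    (hVpos : ∀ᶠ t in comap (fun t : ℝ => |t|) atTop, 0 < V t)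
    (hVgrowth : 1 < liminf (fun t : ℝ => ((Real.log (V t) / Real.log |t| : ℝ) : EReal))
      (comap (fun t : ℝ => |t|) atTop)) :
    -- the Gibbs measures and the Gibbs expectations of the heights are well defined
    (∀ (ε : ℝ≥0) (L : ℕ) (h : (Fin 2 → ℤ) → ℝ),
      IsProbabilityMeasure (PinnedInterface.gibbs V ε (PinnedInterface.box 2 L) h) ∧
      ∀ i : PinnedInterface.box 2 L,
        Integrable (fun φ => φ i) (PinnedInterface.gibbs V ε (PinnedInterface.box 2 L) h)) ∧
    ∃ a : ℝ, 0 < a ∧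
      ∀ (Ω : Type*) [MeasurableSpace Ω] (P : Measure Ω) [IsProbabilityMeasure P]
        (η : (Fin 2 → ℤ) → Ω → ℝ),
        iIndepFun η P →
        (∀ i, IdentDistrib (η i) (η 0) P P) →
        IdentDistrib (η 0) (fun ω => -η 0 ω) P P →
        MemLp (η 0) 2 P →
        ∀ ε : ℝ≥0,
          -- the expected total overlap, an expectation in `(-∞, ∞]`
          ((a * ∫ ω, η 0 ω ^ 2 ∂P : ℝ) : EReal) ≤
            liminf (fun L : ℕ =>
              PinnedInterface.extExpect P (fun ω => ∑ i : PinnedInterface.box 2 L,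
                  η i.1 ω * PinnedInterface.gibbsMean V ε (PinnedInterface.box 2 L)
                    (fun j => η j ω) i)
                / (((L : ℝ) ^ 2 * Real.log L : ℝ) : EReal)) atTop ∧
          -- the sum of the single-site expectations, whenever these exist in `(-∞, ∞]`
          ((∀ᶠ L : ℕ in atTop, ∀ i : PinnedInterface.box 2 L,
              PinnedInterface.extExpect P (fun ω => η i.1 ω *
                PinnedInterface.gibbsMean V ε (PinnedInterface.box 2 L) (fun j => η j ω) i) ≠ ⊥) →
            ((a * ∫ ω, η 0 ω ^ 2 ∂P : ℝ) : EReal) ≤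
              liminf (fun L : ℕ =>
                (∑ i : PinnedInterface.box 2 L,
                  PinnedInterface.extExpect P (fun ω => η i.1 ω *
                    PinnedInterface.gibbsMean V ε (PinnedInterface.box 2 L) (fun j => η j ω) i))
                  / (((L : ℝ) ^ 2 * Real.log L : ℝ) : EReal)) atTop) := by
  have hVc : Continuous V := hV1.continuous
  have hV := PinnedInterface.exists_linear_le hVc hVpos hVgrowth
  obtain ⟨A, hA, hVA⟩ := PinnedInterface.exists_add_le_add_sq hV1 hV2 hVsup
  refine ⟨fun ε L h => ⟨PinnedInterface.isProbabilityMeasure_gibbs hVc hV ε L h,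
    PinnedInterface.integrable_height hVc hV ε L h⟩, 1 / 288, by norm_num, ?_⟩
  intro Ω _ P _ η hind hid hsymm hL2 ε
  obtain ⟨D, hD⟩ :=
    PinnedInterface.exists_integrable_le_overlap hVc hV hA hVA hind hid hsymm hL2 ε
  have hlower : ∀ L : ℕ, 2 ≤ L →
      ((1 / 288 * (∫ ω, η 0 ω ^ 2 ∂P) * ((L : ℝ) ^ 2 * Real.log L) - D * (L : ℝ) ^ 2 : ℝ) : EReal)
        ≤ PinnedInterface.extExpect P (fun ω => ∑ i : PinnedInterface.box 2 L,
          η i.1 ω * PinnedInterface.gibbsMean V ε (PinnedInterface.box 2 L)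
            (fun j => η j ω) i) := by
    intro L hL
    obtain ⟨W, hWi, hWle, hWint⟩ := hD L hL
    exact (EReal.coe_le_coe_iff.mpr hWint).trans
      (PinnedInterface.integral_le_extExpect hWi hWle)
  refine ⟨PinnedInterface.le_liminf_of_log_bound ((eventually_ge_atTop 2).mono hlower),
    fun hbot => PinnedInterface.le_liminf_of_log_bound (D := D) ?_⟩
  filter_upwards [hbot, eventually_ge_atTop 2] with L hb hL
  -- The bound for the total overlap passes to the sum of single-site expectations by subadditivity,
  -- which requires each term to be measurable and not `⊥`.
  refine (hlower L hL).trans (PinnedInterface.extExpect_sum_le (fun i => ?_) hb)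
  have hη : ∀ i, AEMeasurable (η i) P := fun i => (hid i).aemeasurable_fst
  exact (hη i.1).mul ((PinnedInterface.measurable_gibbsMean hVc ε _ i).comp_aemeasurable
    (aemeasurable_pi_lambda _ hη))
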